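/- **Setting.** A deterministic system with horizon $H$ has a state space $\mathcal S$ that is the disjoint union of the levels $\mathcal S_1,\dots,\mathcal S_H$, an action space $\mathcal A$, a fixed initial state $s_1\in\mathcal S_1$, a deterministic transition function that maps $\mathcal S_h\times\mathcal A$ into $\mathcal S_{h+1}$ for $h<H$, and a reward function $r:\mathcal S\times\mathcal A\to\mathbb R$ such that the total reward of every episode (that is, of $H$ steps from $s_1$) lies in $[0,1]$. A policy maps each state to a distribution over actions. $V^\pi(s)$ is the expected total reward collected from $s$ to the end of the episode under $\pi$, and $Q^\pi(s,a)$ is the same when the first action is $a$; $V^*=\sup_\pi V^\pi$ and $Q^*=\sup_\pi Q^\pi$. The optimality gap is $\rho=\inf_{Q^*(s,a)\ne V^*(s)}\bigl(V^*(s)-Q^*(s,a)\bigr)$. A policy $\pi$ is $1/2$-optimal if $V^\pi(s_1)\ge V^*(s_1)-1/2$. An algorithm is randomized and adaptive: it samples full trajectories from $s_1$, chooses every action from all it has observed, and may stop after any number of completed trajectories and return a policy; it may depend on everything below (including the family and the features), but does not know which member of the family it interacts with. **Proposition.** There are universal constants $K,c>0$ such that for all integers $2\le C\le H$ and $d\ge1$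 and every $\delta\ge\sqrt{K\,C^2/d}$ there exist finite sets $\mathcal S,\mathcal A$, a feature extractor $\phi:\mathcal S\times\mathcal A\to\mathbb R^d$ with $\|\phi(s,a)\|_2\le1$, and a family of deterministic systems with horizon $H$ on $\mathcal S,\mathcal A$, such that 1. every system of the family has optimality gap $\rho=1$; 2. for every system of the family there is a single vector $\theta\in\mathbb R^d$ with $\|\theta\|_2\le B$ and $|Q^*(s,a)-\theta^\top\phi(s,a)|\le\delta$ for all $(s,a)\in\mathcal S\times\mathcal A$; 3. for any algorithm that, on each system of the family, returns a $1/2$-optimal policy with probability at least $0.9$, there is a system of the family on which, with probability at least $1/2$, it samples at least $c\,2^C$ trajectories. This holds both with $|\mathcal A|=2$ and $B=\sqrt C$, and (for another family) with $|\mathcal A|=2^C$ and $B=1$. -/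

import Mathlib

noncomputable section

namespace DetRL

/-- Reward collected by playing the listed actions in order, starting in the given state. -/
def totalReward {S A : Type} (next : S → A → S) (reward : S → A → ℝ) : List A → S → ℝ
  | [], _ => 0
  | a :: l, s => reward s a + totalReward next reward l (next s a)

/-- An episodic system with horizon `H`, deterministic transitions and deterministic rewards.
The sets of states at the levels `1, …, H` are disjoint (they are the fibres of `level`), the
initial state is fixed, and the total reward of every episode lies in `[0, 1]`. The value of
`next` at a state of level `H` plays no role, since the episode ends there. -/
structure DeterministicSystem (S A : Type) (H : ℕ) where
  level : S → ℕ
  one_le_level : ∀ s, 1 ≤ level s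
  level_le : ∀ s, level s ≤ H
  init : S
  level_init : level init = 1
  next : S → A → S
  level_next : ∀ s a, level s < H → level (next s a) = level s + 1
  reward : S → A → ℝ
  totalReward_mem : ∀ l : List A, l.length = H →
    totalReward next reward l init ∈ Set.Icc (0 : ℝ) 1

/-- A (randomized) policy prescribes a distribution over actions for each state. -/
abbrev Policy (S A : Type) : Type := S → PMF A

namespace DeterministicSystem

variable {S A : Type} {H : ℕ} [Fintype A]

/-- Expected reward of the next `n` steps when `π` is followed from the state `s`. -/
def expectedReward (M : DeterministicSystem S A H) (π : Policy S A) : ℕ → S → ℝ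
  | 0, _ => 0
  | n + 1, s => ∑ a, (π s a).toReal * (M.reward s a + expectedReward M π n (M.next s a))

/-- `V^π(s)`: expected reward of the steps `level s, …, H` from `s` under `π`. -/
def V (M : DeterministicSystem S A H) (π : Policy S A) (s : S) : ℝ :=
  M.expectedReward π (H + 1 - M.level s) s

/-- `Q^π(s, a)`: the same, when the first action is `a` and `π` is followed afterwards. -/
def Q (M : DeterministicSystem S A H) (π : Policy S A) (s : S) (a : A) : ℝ :=
  M.reward s a + M.expectedReward π (H - M.level s) (M.next s a)

/-- The optimal value function. -/
def Vstar (M : DeterministicSystem S A H) (s : S) : ℝ := ⨆ π : Policy S A, M.V π s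

/-- The optimal `Q`-function. -/
def Qstar (M : DeterministicSystem S A H) (s : S) (a : A) : ℝ := ⨆ π : Policy S A, M.Q π s a

/-- The optimality gap `inf_{Q*(s, a) ≠ V*(s)} (V*(s) - Q*(s, a))`. -/
def gap (M : DeterministicSystem S A H) : ℝ :=
  sInf {x : ℝ | ∃ s a, M.Qstar s a ≠ M.Vstar s ∧ x = M.Vstar s - M.Qstar s a}

/-- `π` is an `ε`-optimal policy: its expected total reward is within `ε` of the optimum. -/
def IsNearOptimal (M : DeterministicSystem S A H) (ε : ℝ) (π : Policy S A) : Prop :=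
  M.Vstar M.init - ε ≤ M.V π M.init

end DeterministicSystem

/-- A recorded (possibly partial) trajectory `(s₁, a₁, r₁), (s₂, a₂, r₂), …`. -/
abbrev Trajectory (S A : Type) : Type := List (S × A × ℝ)

/-- A randomized adaptive learning algorithm. It has access to a random seed `ω`. Given the
trajectories sampled so far, it decides whether to halt; if it halts it returns the policy
`output`, otherwise it samples one more trajectory, choosing each action by `act` from the
completed trajectories, the current trajectory so far, and the current state. -/
structure Algorithm (S A : Type) where
  Ω : Type
  mΩ : MeasurableSpace Ω
  μ : MeasureTheory.Measure Ω
  prob : MeasureTheory.IsProbabilityMeasure μ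
  act : Ω → List (Trajectory S A) → Trajectory S A → S → A
  halt : Ω → List (Trajectory S A) → Bool
  output : Ω → List (Trajectory S A) → Policy S A
  measurable_act : ∀ past current s a, MeasurableSet {ω | act ω past current s = a}
  measurable_halt : ∀ past, MeasurableSet {ω | halt ω past = true}
  measurable_output : ∀ past s a, Measurable fun ω => output ω past s a

/-- Continue the partial trajectory `current` for `n` steps from the state `s`. -/
def rollout {S A : Type} {H : ℕ} (M : DeterministicSystem S A H)
    (choose : Trajectory S A → S → A) : ℕ → S → Trajectory S A → Trajectory S A
  | 0, _, current => current
  | n + 1, s, current =>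
      rollout M choose n (M.next s (choose current s))
        (current ++ [(s, choose current s, M.reward s (choose current s))])

namespace Algorithm

variable {S A : Type} {H : ℕ}

/-- The first `k` full trajectories that the algorithm samples from `M` with seed `ω`
(if it does not stop before). -/
def history (alg : Algorithm S A) (M : DeterministicSystem S A H) (ω : alg.Ω) :
    ℕ → List (Trajectory S A)
  | 0 => []
  | k + 1 => history alg M ω k ++
      [rollout M (alg.act ω (history alg M ω k)) H M.init []]

/-- On `M` and with seed `ω` the algorithm stops after exactly `k` trajectories. -/
def StopsAfter (alg : Algorithm S A) (M : DeterministicSystem S A H) (ω : alg.Ω) (k : ℕ) : Prop :=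
  alg.halt ω (alg.history M ω k) = true ∧ ∀ j < k, alg.halt ω (alg.history M ω j) = false

/-- Probability that the algorithm, run on `M`, stops and returns an `ε`-optimal policy. -/
def successProb [Fintype A] (alg : Algorithm S A) (M : DeterministicSystem S A H) (ε : ℝ) : ℝ :=
  letI := alg.mΩ
  alg.μ.real {ω | ∃ k, alg.StopsAfter M ω k ∧
    M.IsNearOptimal ε (alg.output ω (alg.history M ω k))}

/-- Probability that the algorithm, run on `M`, samples at least `x` trajectories
(seeds with which it never stops are included). -/
def sampleProb (alg : Algorithm S A) (M : DeterministicSystem S A H) (x : ℝ) : ℝ :=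
  letI := alg.mΩ
  alg.μ.real {ω | ∀ k : ℕ, alg.StopsAfter M ω k → x ≤ k}

end Algorithm

/-- A family of deterministic systems with a common feature extractor `φ` such that
* features have norm at most one;
* every system has optimality gap `1`;
* in every system, `Q*` is within `δ` of one linear function `θᵀφ`, with `‖θ‖ ≤ B`;
* every algorithm that on each system of the family returns a `1/2`-optimal policy with
  probability at least `0.9` samples at least `N` trajectories with probability at least `1/2`
  on some system of the family. -/
structure IsHardFamily {S A : Type} [Fintype A] {H d : ℕ} (δ B N : ℝ)
    (φ : S → A → EuclideanSpace ℝ (Fin d)) (F : Set (DeterministicSystem S A H)) : Prop where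
  norm_feature_le : ∀ s a, ‖φ s a‖ ≤ 1
  gap_eq_one : ∀ M ∈ F, M.gap = 1
  approx : ∀ M ∈ F, ∃ θ : EuclideanSpace ℝ (Fin d), ‖θ‖ ≤ B ∧
    ∀ s a, |M.Qstar s a - inner ℝ θ (φ s a)| ≤ δ
  lower_bound : ∀ alg : Algorithm S A,
    (∀ M ∈ F, 9 / 10 ≤ alg.successProb M (1 / 2)) →
      ∃ M ∈ F, 1 / 2 ≤ alg.sampleProb M N

end DetRL

end

namespace DetRL

/-! The hard systems are combination locks on the tree of action sequences: `needle x` pays 1 for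
completing the code `x` of length `L`, with `|A|^L = 2^C`. Its `Q*` on an edge is 1 if the edge lies
on the path to `x`, and 0 otherwise (`Qstar_needle`), so the gap is 1.

Linear features: by a union bound there are sign vectors, one for each word of length `L`, whose
normalized inner products are at most `δ`. An edge at depth `k` carries its vector in the `k`-th of
`L` orthogonal blocks, and `θ` carries the vector of a prefix of `x` in every block. Then `θᵀφ` is
exactly 1 on the path and at most `δ` in absolute value elsewhere, with `‖θ‖ = √L`
(`exists_prefix_features`). The two claims are the cases `L = C` and `L = 1`.

Lower bound: compare with the lock without rewards, `needle []`. A trajectory can reveal only the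
one code lying on its path (`exists_history_needle_eq`), and one policy is 1/2-optimal for at most
two codes, because its values over all codes sum to at most 1 (`sum_V_needle_le`). So for each seed,
either few codes are solved or almost all codes cost many trajectories; averaging over seeds and
codes finishes (`needle_lower_bound`). -/

theorem sum_toReal_pmf {A : Type} [Fintype A] (p : PMF A) : ∑ a, (p a).toReal = 1 := by
  rw [← ENNReal.toReal_sum (fun a _ => p.apply_ne_top a), ← tsum_fintype (L := .unconditional A), p.tsum_coe,
    ENNReal.toReal_one]

theorem sum_pmf_mul_le {A : Type} [Fintype A] (p : PMF A) {f : A → ℝ} {b : ℝ}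
    (h : ∀ a, f a ≤ b) : ∑ a, (p a).toReal * f a ≤ b := by
  calc ∑ a, (p a).toReal * f a ≤ ∑ a, (p a).toReal * b :=
        Finset.sum_le_sum fun a _ => mul_le_mul_of_nonneg_left (h a) ENNReal.toReal_nonneg
    _ = b := by rw [← Finset.sum_mul, sum_toReal_pmf, one_mul]

/-! ### Bellman equations and verification of optimal values -/

namespace DeterministicSystem

theorem level_induction {S A : Type} {H : ℕ} (M : DeterministicSystem S A H) {P : S → Prop}
    (h : ∀ s, (M.level s < H → ∀ a, P (M.next s a)) → P s) (s : S) : P s := by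
  generalize hn : H - M.level s = n
  induction n using Nat.strong_induction_on generalizing s with
  | _ n ih =>
    refine h s fun hs a => ih _ ?_ (M.next s a) rfl
    rw [M.level_next s a hs]; omega

variable {S A : Type} {H : ℕ} [Fintype A]

theorem V_eq_sum_Q (M : DeterministicSystem S A H) (π : Policy S A) (s : S) :
    M.V π s = ∑ a, (π s a).toReal * M.Q π s a := by
  have h : H + 1 - M.level s = (H - M.level s) + 1 := by have := M.level_le s; omega
  simp only [V, h, expectedReward, Q]

theorem Q_eq (M : DeterministicSystem S A H) (π : Policy S A) (s : S) (a : A) :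
    M.Q π s a = M.reward s a + if M.level s < H then M.V π (M.next s a) else 0 := by
  split_ifs with h
  · have h' : H + 1 - M.level (M.next s a) = H - M.level s := by
      rw [M.level_next s a h]; omega
    rw [V, h', Q]
  · have h' : H - M.level s = 0 := by omega
    rw [Q, h', expectedReward]

/-- The right-hand side of the Bellman equation with value function `w`. -/
def backup (M : DeterministicSystem S A H) (w : S → ℝ) (s : S) (a : A) : ℝ :=
  M.reward s a + if M.level s < H then w (M.next s a) else 0

/-- Backward induction over the levels: averaging over actions cannot exceed a bound that holds for
each action. -/
theorem V_le_of_backup_le (M : DeterministicSystem S A H) {w : S → ℝ}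
    (hw : ∀ s a, M.backup w s a ≤ w s) (π : Policy S A) (s : S) : M.V π s ≤ w s := by
  induction s using M.level_induction with
  | _ s ih =>
    rw [V_eq_sum_Q]
    refine sum_pmf_mul_le _ fun a => le_trans ?_ (hw s a)
    rw [Q_eq, backup]
    split_ifs with h
    · linarith [ih h a]
    · exact le_rfl

theorem Q_le_of_backup_le (M : DeterministicSystem S A H) {w : S → ℝ}
    (hw : ∀ s a, M.backup w s a ≤ w s) (π : Policy S A) (s : S) (a : A) :
    M.Q π s a ≤ M.backup w s a := by
  rw [Q_eq, backup]
  split_ifs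
  · linarith [M.V_le_of_backup_le hw π (M.next s a)]
  · exact le_rfl

theorem V_pure_eq (M : DeterministicSystem S A H) {w : S → ℝ} {σ : S → A}
    (hσ : ∀ s, M.backup w s (σ s) = w s) (s : S) :
    M.V (fun s => PMF.pure (σ s)) s = w s := by
  induction s using M.level_induction with
  | _ s ih =>
    rw [V_eq_sum_Q, Finset.sum_eq_single (σ s), PMF.pure_apply_self, ENNReal.toReal_one, one_mul,
      Q_eq, ← hσ s, backup]
    · split_ifs with h
      · rw [ih h]
      · rfl
    · intro b _ hb
      simp [PMF.pure_apply_of_ne _ _ hb]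
    · simp

theorem Q_pure_eq (M : DeterministicSystem S A H) {w : S → ℝ} {σ : S → A}
    (hσ : ∀ s, M.backup w s (σ s) = w s) (s : S) (a : A) :
    M.Q (fun s => PMF.pure (σ s)) s a = M.backup w s a := by
  rw [Q_eq, backup, V_pure_eq M hσ]

/-- The supremum is attained at all states at once by the deterministic policy `σ`, so a solution of
the Bellman equation need only be exhibited. -/
theorem Vstar_eq (M : DeterministicSystem S A H) {w : S → ℝ} {σ : S → A}
    (hw : ∀ s a, M.backup w s a ≤ w s) (hσ : ∀ s, M.backup w s (σ s) = w s) (s : S) :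
    M.Vstar s = w s := by
  have : Nonempty (Policy S A) := ⟨fun s => PMF.pure (σ s)⟩
  refine le_antisymm (ciSup_le fun π => M.V_le_of_backup_le hw π s) ?_
  rw [← V_pure_eq M hσ s]
  exact le_ciSup (f := fun π => M.V π s)
    ⟨w s, Set.forall_mem_range.2 fun π => M.V_le_of_backup_le hw π s⟩ _

theorem Qstar_eq (M : DeterministicSystem S A H) {w : S → ℝ} {σ : S → A}
    (hw : ∀ s a, M.backup w s a ≤ w s) (hσ : ∀ s, M.backup w s (σ s) = w s) (s : S) (a : A) :
    M.Qstar s a = M.backup w s a := by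
  have : Nonempty (Policy S A) := ⟨fun s => PMF.pure (σ s)⟩
  refine le_antisymm (ciSup_le fun π => M.Q_le_of_backup_le hw π s a) ?_
  rw [← Q_pure_eq M hσ s a]
  exact le_ciSup (f := fun π => M.Q π s a)
    ⟨_, Set.forall_mem_range.2 fun π => M.Q_le_of_backup_le hw π s a⟩ _

end DeterministicSystem

/-! ### Combination locks on the action tree -/

/-- Nodes of the tree of action sequences of length less than `H`. -/
abbrev Node (A : Type) (H : ℕ) : Type := {l : List A // l.length < H}

/-- Descend along the edge `a`; at the last level, stay. -/
def Node.child {A : Type} {H : ℕ} (s : Node A H) (a : A) : Node A H :=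
  if h : s.1.length + 1 < H then ⟨s.1 ++ [a], by simpa using h⟩ else s

theorem Node.child_val {A : Type} {H : ℕ} {s : Node A H} (h : s.1.length + 1 < H) (a : A) :
    (s.child a).1 = s.1 ++ [a] := by
  rw [Node.child, dif_pos h]

theorem Node.length_le_child {A : Type} {H : ℕ} (s : Node A H) (a : A) :
    s.1.length ≤ (s.child a).1.length := by
  rw [Node.child]; split_ifs <;> simp

open Classical in
/-- Reward one for completing the action sequence `x`. -/
noncomputable def needleReward {A : Type} {H : ℕ} (x : List A) (s : Node A H) (a : A) : ℝ :=
  if s.1 ++ [a] = x then 1 else 0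

theorem needleReward_of_length_ne {A : Type} {H : ℕ} {x : List A} {s : Node A H}
    (h : s.1.length + 1 ≠ x.length) (a : A) : needleReward x s a = 0 := by
  rw [needleReward, if_neg]
  rintro rfl
  simp at h

theorem totalReward_needle_eq_zero {A : Type} {H : ℕ} {x : List A} (l : List A) (s : Node A H)
    (h : x.length ≤ s.1.length) : totalReward Node.child (needleReward x) l s = 0 := by
  induction l generalizing s with
  | nil => rfl
  | cons a l ih =>
    rw [totalReward, needleReward_of_length_ne (by omega), ih _ (h.trans (s.length_le_child a)),
      add_zero]

/-- The reward is paid at most once, since depth grows at each step. The length condition ends the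
episode before the stationary last level could pay again. -/
theorem totalReward_needle_mem {A : Type} {H : ℕ} (x l : List A) (s : Node A H)
    (h : l.length + s.1.length = H) :
    totalReward Node.child (needleReward x) l s ∈ Set.Icc (0 : ℝ) 1 := by
  induction l generalizing s with
  | nil => simp [totalReward]
  | cons a l ih =>
    rw [totalReward]
    have hr : needleReward x s a ∈ Set.Icc (0 : ℝ) 1 := by
      rw [needleReward]; split_ifs <;> simp
    rcases l.eq_nil_or_concat with rfl | hl
    · simpa [totalReward] using hr
    have hlen : s.1.length + 1 < H := by
      obtain ⟨_, _, rfl⟩ := hl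
      simp at h; omega
    by_cases hx : s.1.length + 1 = x.length
    · rw [totalReward_needle_eq_zero, add_zero]
      · exact hr
      · rw [Node.child_val hlen]; simp [hx]
    · rw [needleReward_of_length_ne hx, zero_add]
      refine ih _ ?_
      rw [Node.child_val hlen]
      simp at h ⊢; omega

/-- The combination lock with code `x`. For `x = []` the rewards vanish. -/
noncomputable def needle {A : Type} {H : ℕ} (hH : 0 < H) (x : List A) :
    DeterministicSystem (Node A H) A H where
  level s := s.1.length + 1
  one_le_level s := by omega
  level_le s := s.2
  init := ⟨[], hH⟩
  level_init := rfl
  next := Node.child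
  level_next s a h := by rw [Node.child_val h]; simp
  reward := needleReward x
  totalReward_mem l hl := totalReward_needle_mem x l _ (by simpa using hl)

/-! ### Optimal values, gap, and values summed over codes -/

section Value

variable {A : Type} {H : ℕ} {hH : 0 < H} {x : List A}

open Classical in
/-- The optimal value function of `needle x`. -/
noncomputable def needleValue (x : List A) (s : Node A H) : ℝ :=
  if s.1 <+: x ∧ s.1 ≠ x then 1 else 0

-- The immediate reward covers the case of the full code and the continuation value that of a proper
-- prefix; the two never overlap.
open Classical in
theorem backup_needle (hx : x.length ≤ H) (s : Node A H) (a : A) :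
    (needle hH x).backup (needleValue x) s a = if s.1 ++ [a] <+: x then 1 else 0 := by
  change needleReward x s a + (if s.1.length + 1 < H then needleValue x (s.child a) else 0) = _
  by_cases h : s.1 ++ [a] = x
  · rw [needleReward, if_pos h, if_pos (show s.1 ++ [a] <+: x by rw [h])]
    by_cases hs : s.1.length + 1 < H
    · rw [if_pos hs, needleValue, Node.child_val hs, if_neg (by simp [h]), add_zero]
    · rw [if_neg hs, add_zero]
  · rw [needleReward, if_neg h, zero_add]
    split_ifs with hs hp hp
    · rw [needleValue, Node.child_val hs, if_pos ⟨hp, h⟩]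
    · rw [needleValue, Node.child_val hs, if_neg (fun h' => hp h'.1)]
    · refine absurd (hp.eq_of_length_le ?_) h
      simp; omega
    · rfl

theorem append_singleton_prefix {l : List A} {a : A} (h : l ++ [a] <+: x) : l <+: x ∧ l ≠ x := by
  refine ⟨(List.prefix_append l [a]).trans h, ?_⟩
  rintro rfl
  simpa using h.length_le

theorem backup_needle_le (hx : x.length ≤ H) (s : Node A H) (a : A) :
    (needle hH x).backup (needleValue x) s a ≤ needleValue x s := by
  classical
  rw [backup_needle hx, needleValue]
  by_cases h : s.1 ++ [a] <+: x
  · rw [if_pos h, if_pos (append_singleton_prefix h)]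
  · rw [if_neg h]; split_ifs <;> simp

theorem exists_backup_needle_eq [Nonempty A] (hx : x.length ≤ H) (s : Node A H) :
    ∃ a, (needle hH x).backup (needleValue x) s a = needleValue x s := by
  classical
  simp_rw [backup_needle hx]
  by_cases h : s.1 <+: x ∧ s.1 ≠ x
  · obtain ⟨⟨t, ht⟩, hne⟩ := h
    cases t with
    | nil => simp at ht; exact absurd ht hne
    | cons a t =>
      have hp : s.1 ++ [a] <+: x := ⟨t, by simpa using ht⟩
      exact ⟨a, by rw [if_pos hp, needleValue, if_pos (append_singleton_prefix hp)]⟩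
  · inhabit A
    exact ⟨default, by rw [if_neg (fun h' => h (append_singleton_prefix h')), needleValue, if_neg h]⟩

theorem Vstar_needle [Fintype A] [Nonempty A] (hx : x.length ≤ H) (s : Node A H) :
    (needle hH x).Vstar s = needleValue x s := by
  choose σ hσ using exists_backup_needle_eq (hH := hH) hx
  exact DeterministicSystem.Vstar_eq _ (backup_needle_le hx) hσ s

open Classical in
theorem Qstar_needle [Fintype A] [Nonempty A] (hx : x.length ≤ H) (s : Node A H) (a : A) :
    (needle hH x).Qstar s a = if s.1 ++ [a] <+: x then 1 else 0 := by
  choose σ hσ using exists_backup_needle_eq (hH := hH) hx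
  rw [DeterministicSystem.Qstar_eq _ (backup_needle_le hx) hσ, backup_needle hx]

theorem Vstar_needle_init [Fintype A] [Nonempty A] (hx : x.length ≤ H) (h0 : x ≠ []) :
    (needle hH x).Vstar (needle hH x).init = 1 := by
  rw [Vstar_needle hx, needleValue, if_pos]
  exact ⟨List.nil_prefix, h0.symm⟩

/-- All optimal values are 0 or 1, so every positive difference is 1; a wrong first action shows
that one occurs. -/
theorem gap_needle [Fintype A] [Nontrivial A] (hx : x.length ≤ H) (h0 : x ≠ []) :
    (needle hH x).gap = 1 := by
  classical
  have : {r : ℝ | ∃ s a, (needle hH x).Qstar s a ≠ (needle hH x).Vstar s ∧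
      r = (needle hH x).Vstar s - (needle hH x).Qstar s a} = {1} := by
    ext r
    simp only [Set.mem_ofPred_eq, Set.mem_singleton_iff]
    constructor
    · rintro ⟨s, a, hne, rfl⟩
      rw [Vstar_needle hx, needleValue, Qstar_needle hx] at *
      by_cases h : s.1 ++ [a] <+: x
      · rw [if_pos h, if_pos (append_singleton_prefix h)] at hne
        exact absurd rfl hne
      · rw [if_neg h] at hne ⊢
        split_ifs at hne ⊢ with h'
        · simp
        · simp at hne
    · rintro rfl
      obtain ⟨b, hb⟩ := exists_ne (x.head h0)
      have hp : ¬ ([] ++ [b] <+: x) := by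
        rintro ⟨t, rfl⟩
        simp at hb
      refine ⟨(needle hH x).init, b, ?_⟩
      have hq : (needle hH x).Qstar (needle hH x).init b = 0 := by
        rw [Qstar_needle hx]; exact if_neg hp
      rw [Vstar_needle_init hx h0, hq]
      simp
  rw [DeterministicSystem.gap, this, csInf_singleton]

theorem isNearOptimal_needle_iff [Fintype A] [Nonempty A] (hx : x.length ≤ H) (h0 : x ≠ [])
    (π : Policy (Node A H) A) :
    (needle hH x).IsNearOptimal (1 / 2) π ↔ 1 / 2 ≤ (needle hH x).V π (needle hH x).init := by
  rw [DeterministicSystem.IsNearOptimal, Vstar_needle_init hx h0]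
  norm_num

/-- Transitions do not depend on the code, so these values are the probabilities, under one process,
of the disjoint events of completing the different codes. -/
theorem sum_V_needle_le [Fintype A] {L : ℕ} (hL : L ≤ H) (π : Policy (Node A H) A)
    (s : Node A H) : ∑ x : List.Vector A L, (needle hH x.1).V π s ≤ 1 := by
  classical
  induction s using (needle hH ([] : List A)).level_induction with
  | _ s ih =>
    simp_rw [DeterministicSystem.V_eq_sum_Q]
    rw [Finset.sum_comm]
    simp_rw [← Finset.mul_sum]
    refine sum_pmf_mul_le _ fun a => ?_
    -- Before the last letter of the code nothing is paid and the sum passes to the child;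
    -- afterwards the edge can complete at most one code.
    by_cases hs : s.1.length + 1 < L
    · have hs' : s.1.length + 1 < H := hs.trans_le hL
      refine le_trans (le_of_eq (Finset.sum_congr rfl fun x _ => ?_)) (ih hs' a)
      rw [DeterministicSystem.Q_eq, if_pos (show (needle hH x.1).level s < H from hs')]
      change needleReward x.1 s a + _ = _
      rw [needleReward_of_length_ne (by rw [x.2]; omega), zero_add]
      rfl
    · have hle : ∀ x : List.Vector A L,
          (needle hH x.1).Q π s a ≤ if s.1 ++ [a] = x.1 then 1 else 0 := by
        intro x
        have hx : x.1.length ≤ H := x.2.trans_le hL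
        refine (DeterministicSystem.Q_le_of_backup_le _ (backup_needle_le hx) π s a).trans ?_
        rw [backup_needle hx]
        split_ifs with h1 h2
        · exact le_rfl
        · refine absurd (h1.eq_of_length_le ?_) h2
          rw [x.2]; simp; omega
        · exact zero_le_one
        · exact le_rfl
      refine (Finset.sum_le_sum fun x _ => hle x).trans ?_
      rw [Finset.sum_boole]
      have : (Finset.univ.filter fun x : List.Vector A L => s.1 ++ [a] = x.1).card ≤ 1 := by
        refine Finset.card_le_one.2 fun x hx y hy => Subtype.ext ?_
        rw [← (Finset.mem_filter.1 hx).2, ← (Finset.mem_filter.1 hy).2]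
      exact_mod_cast this

end Value

/-! ### Nearly orthogonal sign vectors -/

/-- The sign vectors of a Boolean vector. -/
def signVec {m : ℕ} (y : Fin m → Bool) (j : Fin m) : ℝ := if y j then 1 else -1

theorem signVec_mul_self {m : ℕ} (y : Fin m → Bool) (j : Fin m) : signVec y j * signVec y j = 1 := by
  rw [signVec]; split_ifs <;> norm_num

/-- The exponential sum factorizes over coordinates into `2 cosh t`, and `cosh t ≤ exp (t² / 2)`. -/
theorem sum_exp_signVec_le {m : ℕ} (x : Fin m → Bool) (t : ℝ) :
    ∑ y : Fin m → Bool, Real.exp (t * ∑ j, signVec x j * signVec y j) ≤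
      2 ^ m * Real.exp (m * t ^ 2 / 2) := by
  have h1 : ∀ y : Fin m → Bool, Real.exp (t * ∑ j, signVec x j * signVec y j) =
      ∏ j, Real.exp (t * (signVec x j * if y j then 1 else -1)) := by
    intro y
    rw [Finset.mul_sum, Real.exp_sum]
    rfl
  have h2 : ∀ j, ∑ b : Bool, Real.exp (t * (signVec x j * if b then 1 else -1)) =
      2 * Real.cosh t := by
    intro j
    rw [Fintype.sum_bool, Real.cosh_eq, signVec, mul_div_cancel₀ _ (two_ne_zero' ℝ)]
    by_cases h : x j <;> simp [h, add_comm]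
  simp_rw [h1]
  have h3 := Finset.prod_univ_sum (fun _ : Fin m => (Finset.univ : Finset Bool))
    (fun j b => Real.exp (t * (signVec x j * if b then 1 else -1)))
  rw [Fintype.piFinset_univ] at h3
  rw [← h3]
  simp_rw [h2]
  rw [Finset.prod_const, Finset.card_univ, Fintype.card_fin, mul_pow]
  refine mul_le_mul_of_nonneg_left ?_ (by positivity)
  calc Real.cosh t ^ m ≤ Real.exp (t ^ 2 / 2) ^ m :=
        pow_le_pow_left₀ (Real.cosh_pos t).le (Real.cosh_le_exp_half_sq t) m
    _ = Real.exp (m * t ^ 2 / 2) := by rw [← Real.exp_nat_mul]; ring_nf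

/-- Chernoff bound; the exponential parameter that optimizes it equals the threshold `t`. The factor
2 pays for the two signs. -/
theorem card_correlated_le {m : ℕ} (x : Fin m → Bool) {t : ℝ} (ht : 0 ≤ t) :
    ((Finset.univ.filter fun y : Fin m → Bool =>
      t * m < |∑ j, signVec x j * signVec y j|).card : ℝ) ≤
      2 * (2 ^ m * Real.exp (-(m * t ^ 2 / 2))) := by
  set B := Finset.univ.filter fun y : Fin m → Bool => t * m < |∑ j, signVec x j * signVec y j|
  have key : (B.card : ℝ) * Real.exp (m * t ^ 2) ≤ 2 * (2 ^ m * Real.exp (m * t ^ 2 / 2)) := by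
    calc (B.card : ℝ) * Real.exp (m * t ^ 2) = ∑ _y ∈ B, Real.exp (m * t ^ 2) := by
          rw [Finset.sum_const, nsmul_eq_mul]
      _ ≤ ∑ y ∈ B, (Real.exp (t * ∑ j, signVec x j * signVec y j) +
            Real.exp (-t * ∑ j, signVec x j * signVec y j)) := by
          refine Finset.sum_le_sum fun y hy => ?_
          have hy' := (Finset.mem_filter.1 hy).2
          rcases lt_abs.1 hy' with h | h
          · refine le_add_of_le_of_nonneg (Real.exp_le_exp.2 ?_) (Real.exp_pos _).le
            nlinarith [mul_le_mul_of_nonneg_left h.le ht]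
          · refine le_add_of_nonneg_of_le (Real.exp_pos _).le (Real.exp_le_exp.2 ?_)
            nlinarith [mul_le_mul_of_nonneg_left h.le ht]
      _ ≤ ∑ y, (Real.exp (t * ∑ j, signVec x j * signVec y j) +
            Real.exp (-t * ∑ j, signVec x j * signVec y j)) :=
          Finset.sum_le_univ_sum_of_nonneg fun y => by positivity
      _ ≤ 2 * (2 ^ m * Real.exp (m * t ^ 2 / 2)) := by
          rw [Finset.sum_add_distrib]
          have h1 := sum_exp_signVec_le x t
          have h2 := sum_exp_signVec_le x (-t)
          rw [neg_sq] at h2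
          linarith
  have h := mul_le_mul_of_nonneg_right key (Real.exp_pos (-(m * t ^ 2))).le
  rw [mul_assoc, ← Real.exp_add, add_neg_cancel, Real.exp_zero, mul_one] at h
  refine h.trans (le_of_eq ?_)
  rw [mul_assoc, mul_assoc, ← Real.exp_add]
  ring_nf

/-- Exponentially many sign vectors are nearly orthogonal. -/
theorem exists_nearly_orthogonal_signs (ι : Type) [Fintype ι] (m : ℕ) {t : ℝ} (ht : 0 ≤ t)
    (h : 2 * (Fintype.card ι : ℝ) * Real.exp (-(m * t ^ 2 / 2)) < 1) :
    ∃ u : ι → Fin m → Bool, ∀ i j, i ≠ j →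
      |∑ k, signVec (u i) k * signVec (u j) k| ≤ t * m := by
  classical
  suffices H : ∀ s : Finset ι, ∃ u : ι → Fin m → Bool, ∀ i ∈ s, ∀ j ∈ s, i ≠ j →
      |∑ k, signVec (u i) k * signVec (u j) k| ≤ t * m by
    obtain ⟨u, hu⟩ := H Finset.univ
    exact ⟨u, fun i j => hu i (Finset.mem_univ _) j (Finset.mem_univ _)⟩
  intro s
  induction s using Finset.induction_on with
  | empty => exact ⟨fun _ _ => true, by simp⟩
  | insert a s ha ih =>
    obtain ⟨u, hu⟩ := ih
    obtain ⟨y, hy⟩ : ∃ y : Fin m → Bool, ∀ i ∈ s,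
        |∑ k, signVec (u i) k * signVec y k| ≤ t * m := by
      -- Greedy choice: otherwise the bad sets of the vectors chosen so far would cover the cube,
      -- contradicting their total size.
      by_contra! hcon
      have hsub : (Finset.univ : Finset (Fin m → Bool)) ⊆ s.biUnion fun i =>
          Finset.univ.filter fun y => t * m < |∑ j, signVec (u i) j * signVec y j| := by
        intro y _
        obtain ⟨i, hi, hlt⟩ := hcon y
        exact Finset.mem_biUnion.2 ⟨i, hi, Finset.mem_filter.2 ⟨Finset.mem_univ _, hlt⟩⟩
      have h1 : ((2 : ℝ) ^ m) ≤ ∑ i ∈ s, ((Finset.univ.filter fun y : Fin m → Bool =>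
          t * m < |∑ j, signVec (u i) j * signVec y j|).card : ℝ) := by
        have := (Finset.card_le_card hsub).trans Finset.card_biUnion_le
        rw [Finset.card_univ, Fintype.card_fun, Fintype.card_bool, Fintype.card_fin] at this
        exact_mod_cast this
      have h2 := h1.trans (Finset.sum_le_sum fun i _ => card_correlated_le (u i) ht)
      rw [Finset.sum_const, nsmul_eq_mul] at h2
      have h3 : (s.card : ℝ) ≤ Fintype.card ι := by exact_mod_cast s.card_le_univ
      have h4 : (0 : ℝ) < 2 ^ m := by positivity
      have h5 := mul_le_mul_of_nonneg_right h3
        (by positivity : 0 ≤ 2 * (2 ^ m * Real.exp (-(m * t ^ 2 / 2))))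
      nlinarith
    refine ⟨Function.update u a y, fun i hi j hj hij => ?_⟩
    rcases Finset.mem_insert.1 hi with rfl | hi' <;> rcases Finset.mem_insert.1 hj with rfl | hj'
    · exact absurd rfl hij
    · rw [Function.update_self, Function.update_of_ne hij.symm]
      simpa only [mul_comm] using hy j hj'
    · rw [Function.update_self, Function.update_of_ne hij]
      exact hy i hi'
    · rw [Function.update_of_ne (by rintro rfl; exact ha hi'),
        Function.update_of_ne (by rintro rfl; exact ha hj')]
      exact hu i hi' j hj' hij

/-! ### Block features for prefixes -/

theorem exists_linearIsometry_euclideanSpace (κ : Type) [Fintype κ] {d : ℕ}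
    (h : Fintype.card κ ≤ d) :
    Nonempty (EuclideanSpace ℝ κ →ₗᵢ[ℝ] EuclideanSpace ℝ (Fin d)) := by
  classical
  obtain ⟨e⟩ : Nonempty (κ ↪ Fin d) := Function.Embedding.nonempty_of_card_le (by simpa using h)
  let b := EuclideanSpace.basisFun κ ℝ
  let f := b.toBasis.constr ℝ fun i => EuclideanSpace.basisFun (Fin d) ℝ (e i)
  refine ⟨f.isometryOfOrthonormal (v := b.toBasis) (by simp [b.orthonormal]) ?_⟩
  have : f ∘ b.toBasis = EuclideanSpace.basisFun (Fin d) ℝ ∘ e := by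
    ext1 i
    exact b.toBasis.constr_basis ℝ _ i
  rw [this]
  exact (EuclideanSpace.basisFun (Fin d) ℝ).orthonormal.comp e e.injective

/-- Pad with `a` or truncate to length `L`. -/
def padTo {A : Type} (a : A) (L : ℕ) (y : List A) : List.Vector A L :=
  ⟨(y ++ List.replicate L a).take L, by simp⟩

/-- Words of all lengths share one pool of vectors. Collisions between different lengths are
harmless, because those words live in different blocks. -/
theorem padTo_injOn {A : Type} {a : A} {L : ℕ} {y z : List A} (h : y.length = z.length)
    (hL : y.length ≤ L) (hyz : padTo a L y = padTo a L z) : y = z := by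
  have h1 := congrArg (fun v : List.Vector A L => v.1.take y.length) hyz
  simp only [padTo, List.take_take, min_eq_left hL] at h1
  rwa [List.take_left, h, List.take_left] at h1

/-- Linear features for the prefix indicators: in `L` blocks of dimension `m`. -/
theorem exists_prefix_features (A : Type) [Fintype A] [Nonempty A] {L m d : ℕ} (hm : 0 < m)
    (hd : L * m ≤ d) {t : ℝ} (ht : 0 ≤ t)
    (h : 2 * (Fintype.card A : ℝ) ^ L * Real.exp (-(m * t ^ 2 / 2)) < 1) :
    ∃ φ : List A → EuclideanSpace ℝ (Fin d), (∀ y, ‖φ y‖ ≤ 1) ∧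
      ∀ x : List A, x.length = L → ∃ θ : EuclideanSpace ℝ (Fin d), ‖θ‖ ≤ Real.sqrt L ∧
        ∀ y : List A, y ≠ [] → (y <+: x → inner ℝ θ (φ y) = (1 : ℝ)) ∧
          (¬ y <+: x → |(inner ℝ θ (φ y) : ℝ)| ≤ t) := by
  inhabit A
  obtain ⟨u, hu⟩ := exists_nearly_orthogonal_signs (List.Vector A L) m ht
    (by rw [card_vector]; exact_mod_cast h)
  obtain ⟨T⟩ := exists_linearIsometry_euclideanSpace (Fin L × Fin m) (d := d) (by simpa using hd)
  have hm' : (0 : ℝ) < m := by exact_mod_cast hm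
  have hs : Real.sqrt m * Real.sqrt m = m := Real.mul_self_sqrt hm'.le
  have hs0 : Real.sqrt m ≠ 0 := (Real.sqrt_pos.2 hm').ne'
  let v : List A → Fin m → ℝ := fun y j => signVec (u (padTo default L y)) j / Real.sqrt m
  have hvv : ∀ y z, ∑ j, v y j * v z j =
      (∑ j, signVec (u (padTo default L y)) j * signVec (u (padTo default L z)) j) / m := by
    intro y z
    rw [Finset.sum_div]
    refine Finset.sum_congr rfl fun j _ => ?_
    rw [div_mul_div_comm, hs]
  have hv1 : ∀ y, ∑ j, v y j * v y j = 1 := by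
    intro y
    rw [hvv]
    simp_rw [signVec_mul_self]
    simp [hm'.ne']
  -- `f y` occupies only the block of its length, which gives norm at most 1; `g x` fills every
  -- block with a prefix of `x`. Their inner product compares `y` with the prefix of `x` of the same
  -- length.
  let f : List A → EuclideanSpace ℝ (Fin L × Fin m) := fun y =>
    WithLp.toLp 2 fun p => if p.1.1 + 1 = y.length then v y p.2 else 0
  let g : List A → EuclideanSpace ℝ (Fin L × Fin m) := fun x =>
    WithLp.toLp 2 fun p => v (x.take (p.1.1 + 1)) p.2
  refine ⟨fun y => T (f y), fun y => ?_, fun x hx => ⟨T (g x), ?_, fun y hy => ?_⟩⟩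
  · rw [T.norm_map, ← sq_le_one_iff₀ (norm_nonneg _), EuclideanSpace.real_norm_sq_eq,
      Fintype.sum_prod_type]
    have : ∀ k : Fin L, ∑ j, f y (k, j) ^ 2 = if k.1 + 1 = y.length then 1 else 0 := by
      intro k
      simp only [f, sq]
      split_ifs
      · exact hv1 y
      · simp
    simp_rw [this]
    rw [Finset.sum_boole]
    have h1 : (Finset.univ.filter fun k : Fin L => k.1 + 1 = y.length).card ≤ 1 := by
      refine Finset.card_le_one.2 fun k hk l hl => Fin.ext ?_
      have := (Finset.mem_filter.1 hk).2
      have := (Finset.mem_filter.1 hl).2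
      omega
    exact_mod_cast h1
  · rw [T.norm_map]
    refine Real.le_sqrt_of_sq_le (le_of_eq ?_)
    rw [EuclideanSpace.real_norm_sq_eq, Fintype.sum_prod_type]
    have : ∀ k : Fin L, ∑ j, g x (k, j) ^ 2 = 1 := by
      intro k
      simp only [g, sq]
      exact hv1 _
    simp_rw [this]
    simp
  · have hin : (inner ℝ (T (g x)) (T (f y)) : ℝ) =
        if y.length ≤ L then ∑ j, v (x.take y.length) j * v y j else 0 := by
      rw [T.inner_map_map, PiLp.inner_apply, Fintype.sum_prod_type]
      have hk : ∀ k : Fin L, ∑ j, (inner ℝ (g x (k, j)) (f y (k, j)) : ℝ) =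
          if k.1 + 1 = y.length then ∑ j, v (x.take y.length) j * v y j else 0 := by
        intro k
        simp only [f, g, RCLike.inner_apply, conj_trivial]
        split_ifs with hk
        · simp [hk, mul_comm]
        · simp
      simp_rw [hk]
      have hpos := List.length_pos_of_ne_nil hy
      split_ifs with hl
      · rw [Finset.sum_eq_single ⟨y.length - 1, by omega⟩]
        · rw [if_pos]; simp; omega
        · intro k _ hne
          rw [if_neg]
          intro h'
          exact hne (Fin.ext (by simp; omega))
        · simp
      · refine Finset.sum_eq_zero fun k _ => if_neg ?_
        have := k.2
        omega
    rw [hin]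
    refine ⟨fun hp => ?_, fun hp => ?_⟩
    · rw [if_pos (hx ▸ hp.length_le), ← List.prefix_iff_eq_take.1 hp, hv1]
    · split_ifs with hl
      · rw [hvv, abs_div, abs_of_pos hm', div_le_iff₀ hm']
        refine hu _ _ fun heq => hp (List.prefix_iff_eq_take.2 ?_)
        have hlen : y.length = (x.take y.length).length := by simp; omega
        exact padTo_injOn hlen hl heq.symm
      · simpa using ht

/-! ### Coupling with the system without rewards -/

section Coupling

variable {S A : Type} {H : ℕ}

theorem mem_rollout_of_mem (M : DeterministicSystem S A H) (choose : Trajectory S A → S → A)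
    {n : ℕ} {s : S} {cur : Trajectory S A} {p : S × A × ℝ} (hp : p ∈ cur) :
    p ∈ rollout M choose n s cur := by
  induction n generalizing s cur with
  | zero => exact hp
  | succ n ih => exact ih (List.mem_append_left _ hp)

/-- Two systems with the same transitions produce the same trajectory unless it visits a pair
where the rewards differ. -/
theorem rollout_congr {M M' : DeterministicSystem S A H} (hnext : M.next = M'.next)
    (choose : Trajectory S A → S → A) (n : ℕ) (s : S) (cur : Trajectory S A)
    (h : ∀ p ∈ rollout M' choose n s cur, M.reward p.1 p.2.1 = M'.reward p.1 p.2.1) :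
    rollout M choose n s cur = rollout M' choose n s cur := by
  induction n generalizing s cur with
  | zero => rfl
  | succ n ih =>
    rw [rollout] at h ⊢
    rw [rollout]
    have h0 := h _ (mem_rollout_of_mem M' choose
      (List.mem_append_right cur (List.mem_singleton_self _)))
    simp only at h0
    rw [h0, hnext]
    exact ih _ _ h

/-- In a tree, all edges of one trajectory lie on a single path. The word `y` is detached from the
state when `n = 0`, because the last step does not move. -/
theorem rollout_needle_prefix {hH : 0 < H} (x : List A)
    (choose : Trajectory (Node A H) A → Node A H → A) (n : ℕ) (s : Node A H)
    (cur : Trajectory (Node A H) A) (y : List A) (hn : n ≠ 0 → n + s.1.length = H ∧ y = s.1)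
    (hcur : ∀ p ∈ cur, p.1.1 ++ [p.2.1] <+: y) :
    ∃ z, ∀ p ∈ rollout (needle hH x) choose n s cur, p.1.1 ++ [p.2.1] <+: z := by
  induction n generalizing s cur y with
  | zero => exact ⟨y, hcur⟩
  | succ n ih =>
    obtain ⟨hlen, rfl⟩ := hn (Nat.succ_ne_zero n)
    refine ih _ _ (s.1 ++ [choose cur s]) (fun hn0 => ?_) fun p hp => ?_
    · have hlt : s.1.length + 1 < H := by omega
      change n + (s.child (choose cur s)).1.length = H ∧ _ = (s.child (choose cur s)).1
      rw [Node.child_val hlt]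
      simp; omega
    · rcases List.mem_append.1 hp with hp | hp
      · exact (hcur p hp).trans (List.prefix_append _ _)
      · rw [List.mem_singleton.1 hp]

/-- Every sampled trajectory distinguishes at most one code from the system without rewards. -/
theorem exists_history_needle_eq {hH : 0 < H} (alg : Algorithm (Node A H) A) (ω : alg.Ω) (L : ℕ) :
    ∃ f : ℕ → List A, ∀ (x : List A) (k : ℕ), x.length = L → (∀ j < k, x ≠ f j) →
      alg.history (needle hH x) ω k = alg.history (needle hH []) ω k := by
  have h : ∀ j, ∃ z, ∀ p ∈ rollout (needle hH ([] : List A))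
      (alg.act ω (alg.history (needle hH []) ω j)) H (needle hH ([] : List A)).init [],
      p.1.1 ++ [p.2.1] <+: z := fun j =>
    rollout_needle_prefix [] _ H _ [] [] (fun _ => ⟨rfl, rfl⟩) (by simp)
  choose z hz using h
  -- The only code of length `L` that the path `z j` can complete is its truncation.
  refine ⟨fun j => (z j).take L, fun x k hx hk => ?_⟩
  induction k with
  | zero => rfl
  | succ k ih =>
    rw [Algorithm.history, Algorithm.history, ih fun j hj => hk j (hj.trans k.lt_succ_self)]
    refine congrArg (fun t => _ ++ [t]) ?_
    refine rollout_congr (M := needle hH x) (M' := needle hH []) rfl _ _ _ _ fun p hp => ?_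
    change needleReward x p.1 p.2.1 = needleReward [] p.1 p.2.1
    rw [needleReward, needleReward, if_neg, if_neg]
    · simp
    · intro hpx
      have h1 := List.prefix_iff_eq_take.1 (hz k p hp)
      rw [hpx, hx] at h1
      exact hk k k.lt_succ_self h1

end Coupling

/-! ### Measurability of the events of a run -/

section Measurability

open scoped MeasureTheory

variable {S A : Type} {H : ℕ} [Fintype A]

/-- Splitting on the finitely many next actions fixes the trajectory. The predicate also sees the
seed, since later decisions share it. -/
theorem measurableSet_rollout (alg : Algorithm S A) (M : DeterministicSystem S A H)
    (past : List (Trajectory S A)) {P : alg.Ω → Trajectory S A → Prop}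
    (hP : ∀ t, MeasurableSet[alg.mΩ] {ω | P ω t}) (n : ℕ) (s : S) (cur : Trajectory S A) :
    MeasurableSet[alg.mΩ] {ω | P ω (rollout M (alg.act ω past) n s cur)} := by
  let _ := alg.mΩ
  induction n generalizing s cur with
  | zero => exact hP cur
  | succ n ih =>
    have : {ω | P ω (rollout M (alg.act ω past) (n + 1) s cur)} =
        ⋃ a, {ω | alg.act ω past cur s = a} ∩
          {ω | P ω (rollout M (alg.act ω past) n (M.next s a)
            (cur ++ [(s, a, M.reward s a)]))} := by
      ext ω
      simp [rollout]
    rw [this]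
    exact MeasurableSet.iUnion fun a => (alg.measurable_act past cur s a).inter (ih _ _)

theorem measurableSet_history (alg : Algorithm S A) (M : DeterministicSystem S A H)
    {P : alg.Ω → List (Trajectory S A) → Prop}
    (hP : ∀ t, MeasurableSet[alg.mΩ] {ω | P ω t}) (k : ℕ) :
    MeasurableSet[alg.mΩ] {ω | P ω (alg.history M ω k)} := by
  induction k generalizing P with
  | zero => exact hP []
  | succ k ih =>
    refine ih (P := fun ω h => P ω (h ++ [rollout M (alg.act ω h) H M.init []])) fun h => ?_
    exact measurableSet_rollout alg M h (P := fun ω t => P ω (h ++ [t])) (fun t => hP _) _ _ _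

theorem measurableSet_stopsAfter (alg : Algorithm S A) (M : DeterministicSystem S A H) (k : ℕ) :
    MeasurableSet[alg.mΩ] {ω | alg.StopsAfter M ω k} := by
  let _ := alg.mΩ
  have h1 : ∀ j, MeasurableSet {ω | alg.halt ω (alg.history M ω j) = true} := fun j =>
    measurableSet_history alg M alg.measurable_halt j
  have : {ω | alg.StopsAfter M ω k} = {ω | alg.halt ω (alg.history M ω k) = true} ∩
      ⋂ j, ⋂ (_ : j < k), {ω | alg.halt ω (alg.history M ω j) = true}ᶜ := by
    ext ω
    simp [Algorithm.StopsAfter]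
  rw [this]
  exact (h1 k).inter (MeasurableSet.iInter fun j => MeasurableSet.iInter fun _ => (h1 j).compl)

theorem measurable_expectedReward (alg : Algorithm S A) (M : DeterministicSystem S A H)
    (past : List (Trajectory S A)) (n : ℕ) (s : S) :
    Measurable[alg.mΩ] fun ω => M.expectedReward (alg.output ω past) n s := by
  let _ := alg.mΩ
  induction n generalizing s with
  | zero => exact measurable_const
  | succ n ih =>
    refine Finset.measurable_sum _ fun a _ => ?_
    exact (alg.measurable_output past s a).ennreal_toReal.mul (measurable_const.add (ih _))

theorem measurableSet_success (alg : Algorithm S A) (M : DeterministicSystem S A H) (ε : ℝ) :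
    MeasurableSet[alg.mΩ] {ω | ∃ k, alg.StopsAfter M ω k ∧
      M.IsNearOptimal ε (alg.output ω (alg.history M ω k))} := by
  let _ := alg.mΩ
  simp only [Set.ofPred_exists]
  refine MeasurableSet.iUnion fun k => (measurableSet_stopsAfter alg M k).inter ?_
  refine measurableSet_history alg M (P := fun ω h => M.IsNearOptimal ε (alg.output ω h))
    (fun h => ?_) k
  exact measurableSet_le measurable_const (measurable_expectedReward alg M h _ _)

theorem measurableSet_sample (alg : Algorithm S A) (M : DeterministicSystem S A H) (N : ℝ) :
    MeasurableSet[alg.mΩ] {ω | ∀ k : ℕ, alg.StopsAfter M ω k → N ≤ k} := by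
  let _ := alg.mΩ
  simp only [Set.ofPred_forall]
  refine MeasurableSet.iInter fun k => ?_
  by_cases hk : N ≤ k
  · simp [hk]
  · simp only [hk, imp_false]
    exact (measurableSet_stopsAfter alg M k).compl

end Measurability

/-! ### Counting codes for a fixed seed, and averaging -/

theorem Algorithm.StopsAfter.eq {S A : Type} {H : ℕ} {alg : Algorithm S A}
    {M : DeterministicSystem S A H} {ω : alg.Ω} {j k : ℕ} (hj : alg.StopsAfter M ω j)
    (hk : alg.StopsAfter M ω k) : j = k := by
  rcases lt_trichotomy j k with h | h | h
  · simpa [hj.1] using hk.2 j h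
  · exact h
  · simpa [hk.1] using hj.2 k h

theorem Algorithm.stopsAfter_congr {S A : Type} {H : ℕ} {alg : Algorithm S A}
    {M M' : DeterministicSystem S A H} {ω : alg.Ω} {k : ℕ}
    (h : ∀ j ≤ k, alg.history M ω j = alg.history M' ω j) :
    alg.StopsAfter M ω k ↔ alg.StopsAfter M' ω k := by
  rw [StopsAfter, StopsAfter, h k le_rfl]
  refine and_congr_right fun _ => forall₂_congr fun j hj => ?_
  rw [h j hj.le]

open Classical in
/-- With few trajectories, a seed either samples on through almost all codes or fails on many. -/
theorem card_success_or_card_sample {A : Type} [Fintype A] [Nonempty A] {H L : ℕ} {hH : 0 < H}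
    (hL : 0 < L) (hLH : L ≤ H) (alg : Algorithm (Node A H) A) (ω : alg.Ω) {N : ℝ} (hN : 0 < N) :
    ((Finset.univ.filter fun x : List.Vector A L => ∃ k, alg.StopsAfter (needle hH x.1) ω k ∧
        (needle hH x.1).IsNearOptimal (1 / 2)
          (alg.output ω (alg.history (needle hH x.1) ω k))).card : ℝ) ≤ N + 2 ∨
      (Fintype.card (List.Vector A L) : ℝ) - N ≤
        (Finset.univ.filter fun x : List.Vector A L =>
          ∀ k : ℕ, alg.StopsAfter (needle hH x.1) ω k → N ≤ k).card := by
  obtain ⟨f, hf⟩ := exists_history_needle_eq (hH := hH) alg ω L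
  -- The largest natural number below `N`: fewer than `N` trajectories means at most `n`.
  set n := ⌈N⌉₊ - 1
  have hceil : 0 < ⌈N⌉₊ := Nat.ceil_pos.2 hN
  have hnN : (n : ℝ) < N := Nat.lt_ceil.1 (by omega)
  have hNn : ∀ k : ℕ, n < k → N ≤ k := fun k hk => Nat.ceil_le.1 (by omega)
  set W := Finset.univ.filter fun x : List.Vector A L => ∃ j < n, x.1 = f j with hW
  have hWcard : W.card ≤ n := by
    have : W.card ≤ ((Finset.range n).image f).card := by
      refine Finset.card_le_card_of_injOn Subtype.val (fun x hx => ?_)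
        Subtype.val_injective.injOn
      obtain ⟨j, hj, hxj⟩ := (Finset.mem_filter.1 hx).2
      simp only [Finset.coe_image, Finset.coe_range, Set.mem_image, Set.mem_Iio]
      exact ⟨j, hj, hxj.symm⟩
    exact this.trans (Finset.card_image_le.trans (Finset.card_range n).le)
  have hWcard' : (W.card : ℝ) ≤ N := le_trans (by exact_mod_cast hWcard) hnN.le
  have hhist : ∀ x : List.Vector A L, x ∉ W → ∀ k ≤ n,
      alg.history (needle hH x.1) ω k = alg.history (needle hH []) ω k := by
    intro x hx k hk
    refine hf x.1 k x.2 fun j hj hxj => hx ?_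
    exact Finset.mem_filter.2 ⟨Finset.mem_univ _, j, hj.trans_le hk, hxj⟩
  -- If the run without rewards stops by time `n`, all codes outside `W` receive the same policy;
  -- otherwise all of them cost at least `N` trajectories.
  by_cases hhalt : ∃ k ≤ n, alg.StopsAfter (needle hH ([] : List A)) ω k
  · left
    obtain ⟨k, hk, hhalt⟩ := hhalt
    set π := alg.output ω (alg.history (needle hH []) ω k)
    set R := Finset.univ.filter fun x : List.Vector A L =>
      1 / 2 ≤ (needle hH x.1).V π (needle hH x.1).init
    -- Nonnegative values with sum at most 1: at most two of them reach 1/2.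
    have hR : (R.card : ℝ) ≤ 2 := by
      have h0 : ∀ x : List.Vector A L, 0 ≤ (needle hH x.1).V π (needle hH x.1).init := by
        intro x
        generalize (needle hH x.1).init = s
        induction s using (needle hH x.1).level_induction with
        | _ s ih =>
          rw [DeterministicSystem.V_eq_sum_Q]
          refine Finset.sum_nonneg fun a _ => mul_nonneg ENNReal.toReal_nonneg ?_
          rw [DeterministicSystem.Q_eq]
          refine add_nonneg ?_ ?_
          · change 0 ≤ needleReward x.1 s a
            rw [needleReward]; split_ifs <;> simp
          · split_ifs with h
            · exact ih h a
            · exact le_rfl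
      have h1 : ∑ x ∈ R, (1 / 2 : ℝ) ≤ 1 :=
        calc ∑ x ∈ R, (1 / 2 : ℝ) ≤ ∑ x ∈ R, (needle hH x.1).V π (needle hH x.1).init :=
              Finset.sum_le_sum fun x hx => (Finset.mem_filter.1 hx).2
          _ ≤ ∑ x : List.Vector A L, (needle hH x.1).V π (needle hH x.1).init :=
              Finset.sum_le_univ_sum_of_nonneg h0
          _ ≤ 1 := sum_V_needle_le hLH π (needle hH ([] : List A)).init
      rw [Finset.sum_const, nsmul_eq_mul] at h1
      linarith
    have hsub : (Finset.univ.filter fun x : List.Vector A L =>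
        ∃ k, alg.StopsAfter (needle hH x.1) ω k ∧ (needle hH x.1).IsNearOptimal (1 / 2)
          (alg.output ω (alg.history (needle hH x.1) ω k))) ⊆ W ∪ R := by
      intro x hx
      by_cases hxW : x ∈ W
      · exact Finset.mem_union_left _ hxW
      refine Finset.mem_union_right _ (Finset.mem_filter.2 ⟨Finset.mem_univ _, ?_⟩)
      obtain ⟨k', hk', hopt⟩ := (Finset.mem_filter.1 hx).2
      have hs := (Algorithm.stopsAfter_congr fun j hj => hhist x hxW j (hj.trans hk)).2 hhalt
      rw [hk'.eq hs, hhist x hxW k hk, isNearOptimal_needle_iff (x.2.trans_le hLH)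
        (List.ne_nil_of_length_pos (x.2.symm ▸ hL))] at hopt
      exact hopt
    have := (Finset.card_le_card hsub).trans (Finset.card_union_le _ _)
    have : ((Finset.univ.filter fun x : List.Vector A L =>
        ∃ k, alg.StopsAfter (needle hH x.1) ω k ∧ (needle hH x.1).IsNearOptimal (1 / 2)
          (alg.output ω (alg.history (needle hH x.1) ω k))).card : ℝ) ≤ W.card + R.card := by
      exact_mod_cast this
    linarith
  · right
    have hsub : Wᶜ ⊆ Finset.univ.filter fun x : List.Vector A L =>
        ∀ k : ℕ, alg.StopsAfter (needle hH x.1) ω k → N ≤ k := by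
      intro x hx
      have hxW := Finset.mem_compl.1 hx
      refine Finset.mem_filter.2 ⟨Finset.mem_univ _, fun k hk => hNn k ?_⟩
      by_contra! hkn
      exact hhalt ⟨k, hkn,
        (Algorithm.stopsAfter_congr fun j hj => hhist x hxW j (hj.trans hkn)).1 hk⟩
    have h1 : ((Wᶜ).card : ℝ) ≤ _ := Nat.cast_le.2 (Finset.card_le_card hsub)
    have h2 : (W.card : ℝ) + (Wᶜ).card = Fintype.card (List.Vector A L) := by
      exact_mod_cast Finset.card_add_card_compl W
    linarith

open Classical in
theorem sum_measureReal_le {Ω X : Type} [MeasurableSpace Ω] [Fintype X]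
    (μ : MeasureTheory.Measure Ω) [MeasureTheory.IsProbabilityMeasure μ] {G E : X → Ω → Prop}
    (hG : ∀ x, MeasurableSet {ω | G x ω}) (hE : ∀ x, MeasurableSet {ω | E x ω}) {a b : ℝ}
    (h : ∀ ω, ((Finset.univ.filter fun x => G x ω).card : ℝ) ≤
      a + b * (Finset.univ.filter fun x => E x ω).card) :
    ∑ x, μ.real {ω | G x ω} ≤ a + b * ∑ x, μ.real {ω | E x ω} := by
  have key : ∀ G : X → Ω → Prop, (∀ x, MeasurableSet {ω | G x ω}) →
      MeasureTheory.Integrable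
        (fun ω => ((Finset.univ.filter fun x => G x ω).card : ℝ)) μ ∧
      ∑ x, μ.real {ω | G x ω} = ∫ ω, ((Finset.univ.filter fun x => G x ω).card : ℝ) ∂μ := by
    intro G hG
    have hc : (fun ω => ((Finset.univ.filter fun x => G x ω).card : ℝ)) =
        fun ω => ∑ x, {ω | G x ω}.indicator 1 ω := by
      ext ω
      rw [← Finset.sum_boole]
      rfl
    have hi : ∀ x, MeasureTheory.Integrable ({ω | G x ω}.indicator (1 : Ω → ℝ)) μ := fun x =>
      (MeasureTheory.integrable_const (1 : ℝ)).indicator (hG x)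
    rw [hc]
    refine ⟨MeasureTheory.integrable_finsetSum _ fun x _ => hi x, ?_⟩
    rw [MeasureTheory.integral_finsetSum _ fun x _ => hi x]
    exact Finset.sum_congr rfl fun x _ => (MeasureTheory.integral_indicator_one (hG x)).symm
  obtain ⟨hiG, hsG⟩ := key G hG
  obtain ⟨hiE, hsE⟩ := key E hE
  have hmono := MeasureTheory.integral_mono hiG
    ((MeasureTheory.integrable_const a).add (hiE.const_mul b)) h
  rw [hsG, hsE]
  refine hmono.trans (le_of_eq ?_)
  simp only [Pi.add_apply]
  rw [MeasureTheory.integral_add (MeasureTheory.integrable_const a) (hiE.const_mul b),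
    MeasureTheory.integral_const_mul]
  simp

theorem needle_lower_bound {A : Type} [Fintype A] [Nonempty A] {H L : ℕ} (hH : 0 < H)
    (hL : 0 < L) (hLH : L ≤ H) (hcard : 4 ≤ Fintype.card A ^ L)
    (alg : Algorithm (Node A H) A)
    (hsucc : ∀ x : List A, x.length = L → 9 / 10 ≤ alg.successProb (needle hH x) (1 / 2)) :
    ∃ x : List A, x.length = L ∧
      1 / 2 ≤ alg.sampleProb (needle hH x) (1 / 16 * (Fintype.card A : ℝ) ^ L) := by
  classical
  by_contra! hcon
  let _ := alg.mΩ
  have := alg.prob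
  have hc : (Fintype.card (List.Vector A L) : ℝ) = (Fintype.card A : ℝ) ^ L := by
    rw [card_vector]; push_cast; rfl
  have hc4 : (4 : ℝ) ≤ (Fintype.card A : ℝ) ^ L := by exact_mod_cast hcard
  set c : ℝ := (Fintype.card A : ℝ) ^ L
  -- With `N = c / 16` and `c ≥ 4`, the first alternative gives at most `N + 2 ≤ 9c/16` successes.
  -- In the second at least `15c/16` codes are long runs, and `9/16 + 7/15 · 15/16 = 1` covers all
  -- successes. Averaging would give `9/10 ≤ 9/16 + 7/30`, which is false.
  have hmain := sum_measureReal_le alg.μ (X := List.Vector A L) (a := 9 / 16 * c) (b := 7 / 15)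
    (fun x => measurableSet_success alg (needle hH x.1) (1 / 2))
    (fun x => measurableSet_sample alg (needle hH x.1) (1 / 16 * c)) (fun ω => by
      have hall : ((Finset.univ.filter fun x : List.Vector A L =>
          ∃ k, alg.StopsAfter (needle hH x.1) ω k ∧ (needle hH x.1).IsNearOptimal (1 / 2)
            (alg.output ω (alg.history (needle hH x.1) ω k))).card : ℝ) ≤ c := by
        rw [← hc]; exact_mod_cast Finset.card_le_univ _
      have hnn : (0 : ℝ) ≤ ((Finset.univ.filter fun x : List.Vector A L =>
          ∀ k : ℕ, alg.StopsAfter (needle hH x.1) ω k → 1 / 16 * c ≤ k).card : ℝ) :=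
        Nat.cast_nonneg _
      rcases card_success_or_card_sample (hH := hH) hL hLH alg ω
        (show 0 < 1 / 16 * c by linarith) with h | h
      · linarith
      · rw [hc] at h
        linarith)
  have h1 : ∑ _x : List.Vector A L, (9 / 10 : ℝ) ≤
      ∑ x : List.Vector A L, alg.successProb (needle hH x.1) (1 / 2) :=
    Finset.sum_le_sum fun x _ => hsucc x.1 x.2
  have h2 : ∑ x : List.Vector A L, alg.sampleProb (needle hH x.1) (1 / 16 * c) ≤
      ∑ _x : List.Vector A L, (1 / 2 : ℝ) :=
    Finset.sum_le_sum fun x _ => (hcon x.1 x.2).le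
  rw [Finset.sum_const, Finset.card_univ, nsmul_eq_mul, hc] at h1 h2
  have hmain' : ∑ x : List.Vector A L, alg.successProb (needle hH x.1) (1 / 2) ≤
      9 / 16 * c + 7 / 15 * ∑ x : List.Vector A L,
        alg.sampleProb (needle hH x.1) (1 / 16 * c) := hmain
  linarith

/-! ### Choice of parameters -/

/-- Combination locks of depth `L` with prefix features form a hard family. -/
theorem exists_hardFamily {A : Type} [Fintype A] [Nontrivial A] {C H L d : ℕ} (hC : 2 ≤ C)
    (hL : 0 < L) (hLC : L ≤ C) (hCH : C ≤ H) (hd : 1 ≤ d) (hA : Fintype.card A ^ L = 2 ^ C)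
    {δ : ℝ} (hδ : Real.sqrt (16 * (C : ℝ) ^ 2 / (d : ℝ)) ≤ δ) :
    ∃ (φ : Node A H → A → EuclideanSpace ℝ (Fin d)) (F : Set (DeterministicSystem (Node A H) A H)),
      IsHardFamily δ (Real.sqrt L) (1 / 16 * (2 : ℝ) ^ C) φ F := by
  classical
  have hH : 0 < H := by omega
  have hLH : L ≤ H := hLC.trans hCH
  have hδ0 : 0 ≤ δ := (Real.sqrt_nonneg _).trans hδ
  have hA' : (Fintype.card A : ℝ) ^ L = 2 ^ C := by exact_mod_cast hA
  suffices hφ : ∃ φ : Node A H → A → EuclideanSpace ℝ (Fin d), (∀ s a, ‖φ s a‖ ≤ 1) ∧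
      ∀ x : List A, x.length = L → ∃ θ : EuclideanSpace ℝ (Fin d), ‖θ‖ ≤ Real.sqrt L ∧
        ∀ s a, |(if s.1 ++ [a] <+: x then (1 : ℝ) else 0) - inner ℝ θ (φ s a)| ≤ δ by
    obtain ⟨φ, hφ1, hφ2⟩ := hφ
    refine ⟨φ, {M | ∃ x : List A, x.length = L ∧ M = needle hH x}, hφ1, ?_, ?_, ?_⟩
    · rintro _ ⟨x, hx, rfl⟩
      exact gap_needle (hx.trans_le hLH) (List.ne_nil_of_length_pos (hx.symm ▸ hL))
    · rintro _ ⟨x, hx, rfl⟩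
      obtain ⟨θ, hθ, h⟩ := hφ2 x hx
      refine ⟨θ, hθ, fun s a => ?_⟩
      rw [Qstar_needle (hx.trans_le hLH)]
      exact h s a
    · intro alg halg
      have h4 : 4 ≤ Fintype.card A ^ L := by
        rw [hA]
        exact Nat.pow_le_pow_right (n := 2) (by norm_num) hC
      obtain ⟨x, hx, h⟩ := needle_lower_bound hH hL hLH h4 alg
        fun x hx => halg _ ⟨x, hx, rfl⟩
      rw [hA'] at h
      exact ⟨_, ⟨x, hx, rfl⟩, h⟩
  -- For `δ ≥ 1` zero features suffice. For `δ < 1` the hypothesis forces `d > L`, so that the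
  -- blocks have positive dimension.
  rcases le_or_gt 1 δ with h1 | h1
  · refine ⟨fun _ _ => 0, by simp, fun x _ => ⟨0, by simp, fun s a => ?_⟩⟩
    rw [inner_zero_left, sub_zero]
    split_ifs <;> simp [h1, hδ0]
  · have hd0 : (0 : ℝ) < d := by exact_mod_cast hd
    have hC0 : (2 : ℝ) ≤ C := by exact_mod_cast hC
    have hLC' : (L : ℝ) ≤ C := by exact_mod_cast hLC
    have hL0 : (0 : ℝ) < L := by exact_mod_cast hL
    have hsq : 16 * (C : ℝ) ^ 2 ≤ δ ^ 2 * d := by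
      have := (Real.sqrt_le_left hδ0).1 hδ
      rwa [div_le_iff₀ hd0] at this
    have hdC : (L : ℝ) < d := by
      have h2 : δ ^ 2 * d ≤ 1 * d :=
        mul_le_mul_of_nonneg_right (pow_le_one₀ hδ0 h1.le) hd0.le
      nlinarith
    set m := d / L
    have hm : 0 < m := Nat.div_pos (by exact_mod_cast hdC.le) hL
    have hm1 : (1 : ℝ) ≤ m := by exact_mod_cast hm
    -- Rounding `d / L` down loses at most a factor 2.
    have hdm : (d : ℝ) ≤ 2 * L * m := by
      have h2 : d < L * (m + 1) := Nat.lt_mul_div_succ d hL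
      have h3 : (d : ℝ) ≤ L * (m + 1) := by exact_mod_cast h2.le
      nlinarith
    have hmδ : 4 * (C : ℝ) ≤ m * δ ^ 2 / 2 := by
      have h2 : 16 * (C : ℝ) * L ≤ 2 * L * m * δ ^ 2 := by nlinarith [sq_nonneg δ]
      have h3 : (L : ℝ) * (16 * C) ≤ L * (2 * m * δ ^ 2) := by linarith
      have := le_of_mul_le_mul_left h3 hL0
      linarith
    -- The constant 16 leaves exponent `4C`, more than the `1 + C` needed to beat `2 · 2^C`.
    have hexp : 2 * (Fintype.card A : ℝ) ^ L * Real.exp (-(m * δ ^ 2 / 2)) < 1 := by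
      rw [hA', Real.exp_neg, ← div_eq_mul_inv, div_lt_one (Real.exp_pos _)]
      have h2 : (2 : ℝ) ≤ Real.exp 1 := by linarith [Real.add_one_le_exp (1 : ℝ)]
      calc (2 : ℝ) * 2 ^ C ≤ Real.exp 1 * Real.exp 1 ^ C := by gcongr
        _ = Real.exp (1 + C) := by rw [← Real.exp_nat_mul, mul_one, Real.exp_add]
        _ < Real.exp (m * δ ^ 2 / 2) := Real.exp_lt_exp.2 (by linarith)
    obtain ⟨φ, hφ1, hφ2⟩ := exists_prefix_features A hm (Nat.mul_div_le d L) hδ0 hexp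
    refine ⟨fun s a => φ (s.1 ++ [a]), fun s a => hφ1 _, fun x hx => ?_⟩
    obtain ⟨θ, hθ, h⟩ := hφ2 x hx
    refine ⟨θ, hθ, fun s a => ?_⟩
    have h' := h (s.1 ++ [a]) (by simp)
    split_ifs with hp
    · rw [h'.1 hp, sub_self, abs_zero]; exact hδ0
    · rw [zero_sub, abs_neg]; exact h'.2 hp

theorem finite_node (A : Type) [Finite A] (H : ℕ) : Finite (Node A H) :=
  (List.finite_length_lt A H).to_subtype

end DetRL

theorem proposition2 :
    ∃ K c : ℝ, 0 < K ∧ 0 < c ∧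
      ∀ C H d : ℕ, 2 ≤ C → C ≤ H → 1 ≤ d →
        ∀ δ : ℝ, Real.sqrt (K * (C : ℝ) ^ 2 / (d : ℝ)) ≤ δ →
          (∃ (S A : Type) (_ : Finite S) (_ : Fintype A)
              (φ : S → A → EuclideanSpace ℝ (Fin d))
              (F : Set (DetRL.DeterministicSystem S A H)),
            Fintype.card A = 2 ∧
              DetRL.IsHardFamily δ (Real.sqrt C) (c * (2 : ℝ) ^ C) φ F) ∧
          (∃ (S A : Type) (_ : Finite S) (_ : Fintype A)
              (φ : S → A → EuclideanSpace ℝ (Fin d))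
              (F : Set (DetRL.DeterministicSystem S A H)),
            Fintype.card A = 2 ^ C ∧
              DetRL.IsHardFamily δ 1 (c * (2 : ℝ) ^ C) φ F) := by
  refine ⟨16, 1 / 16, by norm_num, by norm_num, fun C H d hC hCH hd δ hδ => ⟨?_, ?_⟩⟩
  · obtain ⟨φ, F, h⟩ := DetRL.exists_hardFamily (A := Bool) (H := H) (L := C) hC (by omega) le_rfl
      hCH hd (by rw [Fintype.card_bool]) hδ
    exact ⟨_, Bool, DetRL.finite_node Bool H, inferInstance, φ, F, Fintype.card_bool, h⟩
  · have : Nontrivial (Fin (2 ^ C)) :=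
      Fin.nontrivial_iff_two_le.2 (Nat.le_self_pow (by omega) 2)
    obtain ⟨φ, F, h⟩ := DetRL.exists_hardFamily (A := Fin (2 ^ C)) (H := H) (L := 1) hC one_pos
      (by omega) hCH hd (by rw [Fintype.card_fin, pow_one]) hδ
    rw [Nat.cast_one, Real.sqrt_one] at h
    exact ⟨_, Fin (2 ^ C), DetRL.finite_node _ H, inferInstance, φ, F, Fintype.card_fin _, h⟩
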